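/- All Banach spaces are real, and $\operatorname{dens}(X)$ is the least cardinality of a dense subset of $X$. Definitions. Let $\aleph$ be an uncountable cardinal. (1) An ultrafilter $\mathscr U$ on a set $I$ is countably incomplete if there is a decreasing sequence $(I_n)$ of members of $\mathscr U$ with $\bigcap_n I_n=\varnothing$. It is $\aleph$-good if, for every set $S$ with $|S|<\aleph$ and every map $f$ from the set $\operatorname{fin}(S)$ of finite subsets of $S$ to $\mathscr U$ which is monotone ($f(A)\supset f(B)$ whenever $A\subset B$), there is a map $g:\operatorname{fin}(S)\to\mathscr U$ which is multiplicative ($g(A\cup B)=g(A)\cap g(B)$ for all $A,B$) and satisfies $g(A)\subset f(A)$ for all $A\in\operatorname{fin}(S)$. (2) The ultraproduct of a family $(X_i)_{i\in I}$ of Banach spaces along $\mathscr U$ is $[X_i]_{\mathscr U}=\ell_\infty(X_i)/c_0^{\mathscr U}(X_i)$ with the quotient norm, where $\ell_\infty(X_i)$ is the space of bounded families $(x_i)$, $x_i\in X_i$, with the sup norm, and $c_0^{\mathscr U}(X_i)=\{(x_i)\in \ell_\infty(X_i):\lim_{\mathscr U(i)}\|x_i\|=0\}$. (3) A Lindenstrauss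 space is a Banach space $E$ such that, for every $\lambda>1$, every finite dimensional subspace $F$ of $E$ is contained in a finite dimensional subspace $G$ of $E$ whose Banach-Mazur distance to $\ell_\infty^n$, $n=\dim G$, is at most $\lambda$. (4) A Banach space $E$ is $(1,\aleph)$-injective if for every Banach space $X$ with $\operatorname{dens}(X)<\aleph$, every subspace $Y\subset X$ and every bounded linear operator $t:Y\to E$ there is a bounded linear operator $T:X\to E$ extending $t$ with $\|T\|\le\|t\|$. Theorem. Let $\aleph$ be an uncountable cardinal, let $\mathscr U$ be a countably incomplete, $\aleph$-good ultrafilter on a set $I$, and let $(X_i)_{i\in I}$ be a family of Banach spaces. If $[X_i]_{\mathscr U}$ is a Lindenstrauss space, then it is $(1,\aleph)$-injective. -/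

import Mathlib

open Filter Topology
open scoped ENNReal lp

universe u v w x

/-- An ultrafilter is countably incomplete if it contains a decreasing sequence of sets with empty
intersection. -/
def CountablyIncomplete {I : Type u} (U : Ultrafilter I) : Prop :=
  ∃ s : ℕ → Set I, Antitone s ∧ (∀ n, s n ∈ U) ∧ ⋂ n, s n = ∅

/-- An ultrafilter `U` on `I` is `κ`-good if, for every set `S` with fewer than `κ` elements, every
monotone map `f` from the finite subsets of `S` to `U` has a multiplicative minorant `g`. Here
monotone means `f B ⊆ f A` for `A ⊆ B`, and multiplicative means `g (A ∪ B) = g A ∩ g B`. -/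
def IsGoodUltrafilter {I : Type u} (U : Ultrafilter I) (κ : Cardinal.{w}) : Prop :=
  ∀ (S : Type w) [DecidableEq S], Cardinal.mk S < κ →
    ∀ f : Finset S → Set I, (∀ A, f A ∈ U) → (∀ A B, A ⊆ B → f B ⊆ f A) →
      ∃ g : Finset S → Set I, (∀ A, g A ∈ U) ∧ (∀ A B, g (A ∪ B) = g A ∩ g B) ∧
        ∀ A, g A ⊆ f A

section Ultraproduct

variable {I : Type u} (U : Ultrafilter I) (X : I → Type v) [∀ i, NormedAddCommGroup (X i)]
  [∀ i, NormedSpace ℝ (X i)]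

/-- The subspace of those bounded families `(x i)` in `ℓ_∞(X i)` whose norms `‖x i‖` tend to `0`
along the ultrafilter `U`. -/
def nullFamilies : Submodule ℝ (lp X ∞) where
  carrier := {f | Tendsto (fun i => ‖f i‖) (U : Filter I) (𝓝 0)}
  zero_mem' := by simp
  add_mem' := by
    intro f g hf hg
    refine squeeze_zero (fun i => norm_nonneg _) (fun i => ?_)
      (by simpa using Tendsto.add hf hg)
    simpa using norm_add_le (f i) (g i)
  smul_mem' := by
    intro c f hf
    have h : Tendsto (fun i => ‖c‖ * ‖f i‖) (U : Filter I) (𝓝 0) := by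
      simpa using Tendsto.const_mul ‖c‖ hf
    simpa [norm_smul] using h

/-- The null families form a closed subspace, so that the quotient seminorm is a norm. -/
instance isClosed_nullFamilies : IsClosed (nullFamilies U X : Set (lp X ∞)) := by
  rw [← isSeqClosed_iff_isClosed]
  intro f g hf hfg
  change Tendsto (fun i => ‖g i‖) (U : Filter I) (𝓝 0)
  rw [Metric.tendsto_nhds]
  intro ε hε
  obtain ⟨n, hn⟩ := (Metric.tendsto_nhds.1 hfg (ε / 2) (half_pos hε)).exists
  have h : Tendsto (fun i => ‖f n i‖) (U : Filter I) (𝓝 0) := hf n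
  filter_upwards [Metric.tendsto_nhds.1 h (ε / 2) (half_pos hε)] with i hi
  rw [Real.dist_eq, sub_zero, abs_norm] at hi ⊢
  have h1 : ‖(f n - g) i‖ ≤ ‖f n - g‖ := lp.norm_apply_le_norm (by simp) _ i
  rw [dist_eq_norm] at hn
  have h2 : ‖g i‖ ≤ ‖f n i‖ + ‖f n i - g i‖ := by
    rw [← norm_sub_rev]
    simpa using norm_add_le (f n i) (g i - f n i)
  have h3 : ‖f n i - g i‖ ≤ ‖f n - g‖ := by simpa using h1
  linarith

/-- The Banach space ultraproduct `[X i]_U = ℓ_∞(X i) / c₀^U(X i)`, with the quotient norm. -/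
abbrev BanachUltraproduct : Type (max u v) := lp X ∞ ⧸ nullFamilies U X

end Ultraproduct

/-- The Banach-Mazur distance of two normed spaces: the infimum of `‖T‖ * ‖T⁻¹‖` over all linear
homeomorphisms `T` (and `∞` if there are none). -/
noncomputable def banachMazurDist (E : Type u) (F : Type v) [NormedAddCommGroup E]
    [NormedSpace ℝ E] [NormedAddCommGroup F] [NormedSpace ℝ F] : ℝ≥0∞ :=
  ⨅ T : E ≃L[ℝ] F, ENNReal.ofReal (‖(T : E →L[ℝ] F)‖ * ‖(T.symm : F →L[ℝ] E)‖)

/-- `E` is an `ℒ_{∞,l}`-space: every finite dimensional subspace `F` lies in a finite dimensional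
subspace `G` whose Banach-Mazur distance to `ℓ_∞^n`, `n = dim G`, is at most `l`.
The type `Fin n → ℝ` carries the sup norm. -/
def IsScriptLInfty (E : Type u) [NormedAddCommGroup E] [NormedSpace ℝ E] (l : ℝ) : Prop :=
  ∀ F : Submodule ℝ E, FiniteDimensional ℝ F →
    ∃ G : Submodule ℝ E, FiniteDimensional ℝ G ∧ F ≤ G ∧
      banachMazurDist G (Fin (Module.finrank ℝ G) → ℝ) ≤ ENNReal.ofReal l

/-- A Lindenstrauss space is a Banach space that is an `ℒ_{∞,l}`-space for every `l > 1`. -/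
def IsLindenstrauss (E : Type u) [NormedAddCommGroup E] [NormedSpace ℝ E] : Prop :=
  CompleteSpace E ∧ ∀ l : ℝ, 1 < l → IsScriptLInfty E l

/-- The density character: the least cardinality of a dense subset. -/
noncomputable def densityCharacter (X : Type x) [TopologicalSpace X] : Cardinal.{x} :=
  sInf {c | ∃ s : Set X, Dense s ∧ Cardinal.mk s = c}

/-- `E` is `(l, κ)`-injective: it is a Banach space and, for every Banach space `X` with
`dens X < κ` and every subspace `Y` of `X`, each operator `t : Y → E` has an extension `T : X → E`
with `‖T‖ ≤ l * ‖t‖`. The spaces `X` range over an arbitrary universe, whence the `lift`s. -/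
def IsCardinalInjective (E : Type u) [NormedAddCommGroup E] [NormedSpace ℝ E]
    (l : ℝ) (κ : Cardinal.{w}) : Prop :=
  CompleteSpace E ∧
    ∀ (X : Type x) [NormedAddCommGroup X] [NormedSpace ℝ X] [CompleteSpace X],
      Cardinal.lift.{w} (densityCharacter X) < Cardinal.lift.{x} κ →
        ∀ (Y : Submodule ℝ X) (t : Y →L[ℝ] E),
          ∃ T : X →L[ℝ] E, (∀ y : Y, T y = t y) ∧ ‖T‖ ≤ l * ‖t‖

/-!
The proof rests on intersection properties of balls.

In `ℓ_∞^n` finitely many balls with `‖c s - c t‖ ≤ r s + r t` have a common point, since coordinate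
by coordinate this is the Helly property of intervals. A Lindenstrauss space contains, almost
isometrically, copies of `ℓ_∞^n` around any finite set of centres, so there finitely many such balls
have a common point after their radii are enlarged by any `ε > 0`
(`IsLindenstrauss.exists_forall_norm_sub_lt_add`).

In an ultraproduct along a countably incomplete `κ`-good ultrafilter, fewer than `κ` balls whose
finite subfamilies almost intersect have a common point
(`BanachUltraproduct.exists_forall_norm_sub_le`). To each finite set `A` of balls with enlarged
radii one attaches the set of those indices `i` for which the representatives of these balls in
`X i` intersect, cut down to the `|A|`-th set of a sequence witnessing countable incompleteness. A
multiplicative minorant `g` of this assignment selects, for each `i`, the balls `p` with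
`i ∈ g {p}`. By countable incompleteness there are only finitely many of them, and by
multiplicativity they intersect in `X i`; points of these intersections represent the common point.

Finally, an operator `t` on a subspace extends to one more vector `x` without increase of norm as
soon as the balls with centres `t y` and radii `‖t‖ * ‖x - y‖`, with `y` in a dense subset of the
subspace, have a common point. Zorn's lemma concludes (`exists_extension_of_one_step`).
-/

/-! ### Norms in the ultraproduct -/

namespace BanachUltraproduct

variable {I : Type u} {U : Ultrafilter I} {X : I → Type v} [∀ i, NormedAddCommGroup (X i)]
  [∀ i, NormedSpace ℝ (X i)]

theorem eventually_norm_lt {f : lp X ∞} {r : ℝ}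
    (h : ‖(Submodule.Quotient.mk f : BanachUltraproduct U X)‖ < r) :
    ∀ᶠ i in (U : Filter I), ‖f i‖ < r := by
  obtain ⟨g, hg, hgr⟩ := QuotientAddGroup.norm_lt_iff.1 h
  have hn : f - g ∈ nullFamilies U X :=
    (Submodule.Quotient.eq (nullFamilies U X)).1 hg.symm
  have ht : Tendsto (fun i => ‖(f - g) i‖) (U : Filter I) (𝓝 0) := hn
  filter_upwards [ht.eventually_lt_const (sub_pos.2 hgr)] with i hi
  have h1 : ‖g i‖ ≤ ‖g‖ := lp.norm_apply_le_norm (by simp) g i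
  have h2 : ‖f i‖ ≤ ‖(f - g) i‖ + ‖g i‖ := by
    simpa using norm_add_le ((f - g) i) (g i)
  linarith

theorem norm_le_of_eventually {f : lp X ∞} {r : ℝ} (hr : 0 ≤ r)
    (h : ∀ᶠ i in (U : Filter I), ‖f i‖ ≤ r) :
    ‖(Submodule.Quotient.mk f : BanachUltraproduct U X)‖ ≤ r := by
  classical
  -- Off the large set where the bound holds, the representative may be replaced by `0`.
  let g₀ : ∀ i, X i := fun i => if ‖f i‖ ≤ r then f i else 0
  have hg₀ : ∀ i, ‖g₀ i‖ ≤ r := by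
    intro i
    by_cases hi : ‖f i‖ ≤ r
    · simp [g₀, hi]
    · simp [g₀, hi, hr]
  let g : lp X ∞ := ⟨g₀, memℓp_infty ⟨r, by rintro _ ⟨i, rfl⟩; exact hg₀ i⟩⟩
  have hfg : (Submodule.Quotient.mk f : BanachUltraproduct U X) = Submodule.Quotient.mk g := by
    refine (Submodule.Quotient.eq (nullFamilies U X)).2 ?_
    change Tendsto (fun i => ‖(f - g) i‖) (U : Filter I) (𝓝 0)
    refine tendsto_const_nhds.congr' ?_
    filter_upwards [h] with i hi
    have : g i = f i := if_pos hi
    simp [this]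
  rw [hfg]
  exact (Submodule.Quotient.norm_mk_le _ g).trans (lp.norm_le_of_forall_le hr hg₀)

/-! ### Intersections of balls in the ultraproduct -/

/-- A saturation property: along a countably incomplete `κ`-good ultrafilter, fewer than `κ` balls
of the ultraproduct have a common point if their finite subfamilies have one up to `ε`. -/
theorem exists_forall_norm_sub_le {κ : Cardinal.{w}} (hκ : Cardinal.aleph0 < κ)
    (hinc : CountablyIncomplete U) (hgood : IsGoodUltrafilter U κ) {S : Type w} [Nonempty S]
    (hS : Cardinal.mk S < κ) (c : S → BanachUltraproduct U X) (r : S → ℝ)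
    (h : ∀ A : Finset S, ∀ ε : ℝ, 0 < ε → ∃ z, ∀ s ∈ A, ‖z - c s‖ < r s + ε) :
    ∃ z, ∀ s, ‖z - c s‖ ≤ r s := by
  classical
  obtain ⟨J, hJanti, hJU, hJ⟩ := hinc
  choose b hb using fun s => Submodule.Quotient.mk_surjective (nullFamilies U X) (c s)
  -- The index `(s, n)` stands for the ball around `c s` with radius enlarged by `1 / (n + 1)`.
  let f : Finset (S × ℕ) → Set I := fun A =>
    J A.card ∩ {i | ∃ z : X i, ∀ p ∈ A, ‖z - b p.1 i‖ < r p.1 + 1 / ((p.2 : ℝ) + 1)}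
  have hfU : ∀ A, f A ∈ U := by
    intro A
    refine inter_mem (hJU _) ?_
    let N := A.sup Prod.snd
    obtain ⟨z, hz⟩ := h (A.image Prod.fst) (1 / ((N : ℝ) + 1)) (by positivity)
    obtain ⟨z, rfl⟩ := Submodule.Quotient.mk_surjective (nullFamilies U X) z
    have hz' : ∀ p ∈ A, ∀ᶠ i in (U : Filter I),
        ‖z i - b p.1 i‖ < r p.1 + 1 / ((p.2 : ℝ) + 1) := by
      intro p hp
      have h1 := hz p.1 (Finset.mem_image_of_mem _ hp)
      rw [← hb, ← Submodule.Quotient.mk_sub] at h1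
      have hN : (p.2 : ℝ) ≤ N := by exact_mod_cast Finset.le_sup (f := Prod.snd) hp
      have h2 : 1 / ((N : ℝ) + 1) ≤ 1 / ((p.2 : ℝ) + 1) := by gcongr
      filter_upwards [eventually_norm_lt h1] with i hi
      have hi' : ‖z i - b p.1 i‖ < r p.1 + 1 / ((N : ℝ) + 1) := hi
      linarith
    have := (Filter.eventually_all_finset A).2 hz'
    exact Filter.mem_of_superset this fun i hi => ⟨z i, hi⟩
  have hfmono : ∀ A B, A ⊆ B → f B ⊆ f A := by
    rintro A B hAB i ⟨hi, z, hz⟩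
    exact ⟨hJanti (Finset.card_le_card hAB) hi, z, fun p hp => hz p (hAB hp)⟩
  have hcard : Cardinal.mk (S × ℕ) < κ := by
    simpa using Cardinal.mul_lt_of_lt hκ.le hS hκ
  obtain ⟨g, hgU, hgmul, hgf⟩ := hgood (S × ℕ) hcard f hfU hfmono
  have hgA : ∀ (i : I) (A : Finset (S × ℕ)), A.Nonempty → (∀ p ∈ A, i ∈ g {p}) → i ∈ g A := by
    intro i A hA
    induction hA using Finset.Nonempty.cons_induction with
    | singleton a => intro h; exact h a (by simp)
    | cons a s ha hs ih =>
      intro h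
      rw [Finset.cons_eq_insert, Finset.insert_eq, hgmul]
      exact ⟨h a (by simp), ih fun p hp => h p (by simp [hp])⟩
  have key : ∀ i, ∃ z : X i, ∀ p : S × ℕ, i ∈ g {p} →
      ‖z - b p.1 i‖ < r p.1 + 1 / ((p.2 : ℝ) + 1) := by
    intro i
    have hfin : {p | i ∈ g {p}}.Finite := by
      by_contra hinf
      obtain ⟨n, hn⟩ : ∃ n, i ∉ J n := by
        by_contra! hall
        have : i ∈ ⋂ n, J n := Set.mem_iInter.2 hall
        simp [hJ] at this
      obtain ⟨A, hA, hAc⟩ := Set.Infinite.exists_subset_card_eq hinf (n + 1)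
      have hAne : A.Nonempty := Finset.card_pos.1 (by omega)
      have := (hgf A (hgA i A hAne fun p hp => hA hp)).1
      rw [hAc] at this
      exact hn (hJanti n.le_succ this)
    rcases hfin.toFinset.eq_empty_or_nonempty with he | hne
    · refine ⟨0, fun p hp => ?_⟩
      have : p ∈ hfin.toFinset := by simpa using hp
      simp [he] at this
    · obtain ⟨-, z, hz⟩ := hgf _ (hgA i hfin.toFinset hne fun p hp => by simpa using hp)
      exact ⟨z, fun p hp => hz p (by simpa using hp)⟩
  choose z hz using key
  obtain ⟨s₀⟩ := ‹Nonempty S›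
  -- Cutting `z` off outside the large set `g {(s₀, 0)}` makes it a bounded family.
  let y₀ : ∀ i, X i := fun i => if i ∈ g {(s₀, 0)} then z i else 0
  have hy₀ : ∀ i, ‖y₀ i‖ ≤ |r s₀| + 1 + ‖b s₀‖ := by
    intro i
    by_cases hi : i ∈ g {(s₀, 0)}
    · have h1 := hz i (s₀, 0) hi
      have h2 : ‖z i‖ ≤ ‖z i - b s₀ i‖ + ‖b s₀ i‖ := by
        simpa using norm_add_le (z i - b s₀ i) (b s₀ i)
      have h3 : ‖b s₀ i‖ ≤ ‖b s₀‖ := lp.norm_apply_le_norm (by simp) _ i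
      have h4 := le_abs_self (r s₀)
      simp only [y₀, if_pos hi]
      norm_num at h1
      linarith
    · simp only [y₀, if_neg hi, norm_zero]
      positivity
  let y : lp X ∞ := ⟨y₀, memℓp_infty ⟨_, by rintro _ ⟨i, rfl⟩; exact hy₀ i⟩⟩
  refine ⟨Submodule.Quotient.mk y, fun s => ?_⟩
  have hlim : Tendsto (fun n : ℕ => r s + 1 / ((n : ℝ) + 1)) atTop (𝓝 (r s)) := by
    simpa using tendsto_one_div_add_atTop_nhds_zero_nat.const_add (r s)
  refine ge_of_tendsto' hlim fun n => ?_
  rw [← hb, ← Submodule.Quotient.mk_sub]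
  have hev : ∀ᶠ i in (U : Filter I), ‖(y - b s) i‖ ≤ r s + 1 / ((n : ℝ) + 1) := by
    filter_upwards [hgU {(s, n)}, hgU {(s₀, 0)}] with i hi hi₀
    have : y i = z i := if_pos hi₀
    simpa [this] using (hz i (s, n) hi).le
  obtain ⟨i, hi⟩ := hev.exists
  exact norm_le_of_eventually ((norm_nonneg _).trans hi) hev

end BanachUltraproduct

/-! ### Intersections of balls in Lindenstrauss spaces -/

/-- The finite intersection property of balls in `ℓ_∞^n`: finitely many balls any two of which meet
have a common point. -/
theorem exists_forall_norm_sub_le_pi {ι S : Type*} [Fintype ι] (A : Finset S) (c : S → ι → ℝ)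
    (r : S → ℝ) (h : ∀ s ∈ A, ∀ t ∈ A, ‖c s - c t‖ ≤ r s + r t) :
    ∃ z : ι → ℝ, ∀ s ∈ A, ‖z - c s‖ ≤ r s := by
  rcases A.eq_empty_or_nonempty with rfl | hA
  · exact ⟨0, by simp⟩
  -- In each coordinate the balls are intervals; the largest left end point lies in all of them.
  refine ⟨fun j => A.sup' hA fun s => c s j - r s, fun s hs => ?_⟩
  have hr : 0 ≤ r s := by
    have := (norm_nonneg _).trans (h s hs s hs)
    linarith
  refine (pi_norm_le_iff_of_nonneg hr).2 fun j => ?_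
  rw [Pi.sub_apply, Real.norm_eq_abs, abs_le]
  constructor
  · have := Finset.le_sup' (fun s => c s j - r s) hs
    linarith
  · suffices A.sup' hA (fun s => c s j - r s) ≤ c s j + r s by linarith
    refine Finset.sup'_le _ _ fun t ht => ?_
    have h1 := (norm_le_pi_norm (c t - c s) j).trans (h t ht s hs)
    rw [Pi.sub_apply, Real.norm_eq_abs] at h1
    linarith [le_abs_self (c t j - c s j)]

/-- Finitely many balls any two of which meet have a common point up to `ε`: the centres lie in an
almost isometric copy of some `ℓ_∞^n`. -/
theorem IsLindenstrauss.exists_forall_norm_sub_lt_add {E : Type*} [NormedAddCommGroup E]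
    [NormedSpace ℝ E] (hE : IsLindenstrauss E) {S : Type*} (A : Finset S) (c : S → E) (r : S → ℝ)
    (h : ∀ s ∈ A, ∀ t ∈ A, ‖c s - c t‖ ≤ r s + r t) {ε : ℝ} (hε : 0 < ε) :
    ∃ z, ∀ s ∈ A, ‖z - c s‖ < r s + ε := by
  classical
  have hr : ∀ s ∈ A, 0 ≤ r s := fun s hs => by
    have := (norm_nonneg _).trans (h s hs s hs)
    linarith
  -- `δ` is so small that `(1 + δ) * r s < r s + ε` for all `s ∈ A`.
  have hR : 0 ≤ ∑ s ∈ A, r s := Finset.sum_nonneg hr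
  set δ : ℝ := ε / (∑ s ∈ A, r s + 1) with hδ
  have hδ0 : 0 < δ := by positivity
  have hδr : ∀ s ∈ A, (1 + δ) * r s < r s + ε := by
    intro s hs
    have h1 : r s < ∑ s ∈ A, r s + 1 := by
      linarith [Finset.single_le_sum hr hs]
    have h2 : δ * r s < δ * (∑ s ∈ A, r s + 1) := mul_lt_mul_of_pos_left h1 hδ0
    have h3 : δ * (∑ s ∈ A, r s + 1) = ε := by
      rw [hδ]; field_simp
    linarith
  have hF : FiniteDimensional ℝ (Submodule.span ℝ (c '' (A : Set S))) :=
    FiniteDimensional.span_of_finite ℝ (A.finite_toSet.image c)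
  obtain ⟨G, hG, hFG, hd⟩ := hE.2 (1 + δ / 2) (by linarith) _ hF
  have hlt : banachMazurDist G (Fin (Module.finrank ℝ G) → ℝ) < ENNReal.ofReal (1 + δ) :=
    hd.trans_lt ((ENNReal.ofReal_lt_ofReal_iff (by linarith)).2 (by linarith))
  obtain ⟨T, hT⟩ := iInf_lt_iff.1 hlt
  have hT' := (ENNReal.ofReal_lt_ofReal_iff (by linarith)).1 hT
  let d : S → G := fun s => if hs : s ∈ A then
    ⟨c s, hFG (Submodule.subset_span (Set.mem_image_of_mem c hs))⟩ else 0
  have hdc : ∀ s ∈ A, (d s : E) = c s := fun s hs => by simp [d, hs]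
  obtain ⟨z, hz⟩ := exists_forall_norm_sub_le_pi A (fun s => T (d s))
    (fun s => ‖(T : G →L[ℝ] (Fin (Module.finrank ℝ G) → ℝ))‖ * r s) (by
      intro s hs t ht
      rw [← map_sub, ← mul_add]
      refine ((T : G →L[ℝ] (Fin (Module.finrank ℝ G) → ℝ)).le_opNorm _).trans ?_
      gcongr
      have := h s hs t ht
      rwa [← hdc s hs, ← hdc t ht] at this)
  refine ⟨(T.symm z : G), fun s hs => ?_⟩
  have h1 : ‖T.symm z - d s‖ ≤ ‖(T.symm : (Fin (Module.finrank ℝ G) → ℝ) →L[ℝ] G)‖ *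
      ‖z - T (d s)‖ := by
    simpa using (T.symm : (Fin (Module.finrank ℝ G) → ℝ) →L[ℝ] G).le_opNorm (z - T (d s))
  have h2 : ‖T.symm z - d s‖ = ‖(T.symm z : E) - c s‖ := by
    rw [← hdc s hs]; rfl
  rw [← h2]
  refine lt_of_le_of_lt ?_ (hδr s hs)
  calc ‖T.symm z - d s‖ ≤ _ := h1
    _ ≤ ‖(T.symm : (Fin (Module.finrank ℝ G) → ℝ) →L[ℝ] G)‖ *
        (‖(T : G →L[ℝ] (Fin (Module.finrank ℝ G) → ℝ))‖ * r s) := by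
      gcongr
      exact hz s hs
    _ = ‖(T : G →L[ℝ] (Fin (Module.finrank ℝ G) → ℝ))‖ *
        ‖(T.symm : (Fin (Module.finrank ℝ G) → ℝ) →L[ℝ] G)‖ * r s := by ring
    _ ≤ (1 + δ) * r s := mul_le_mul_of_nonneg_right hT'.le (hr s hs)

/-! ### Extension of operators -/

/-- If norm bounds of partially defined operators survive the adjunction of one vector, then
operators extend to the whole space with the same bound. -/
theorem exists_extension_of_one_step {X E : Type*} [NormedAddCommGroup X] [NormedSpace ℝ X]
    [NormedAddCommGroup E] [NormedSpace ℝ E] {C : ℝ} (hC : 0 ≤ C)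
    (step : ∀ f : X →ₗ.[ℝ] E, (∀ y : f.domain, ‖f y‖ ≤ C * ‖(y : X)‖) → ∀ x : X,
      ∃ v : E, ∀ y : f.domain, ‖v - f y‖ ≤ C * ‖x - y‖)
    (f : X →ₗ.[ℝ] E) (hf : ∀ y : f.domain, ‖f y‖ ≤ C * ‖(y : X)‖) :
    ∃ T : X →L[ℝ] E, (∀ y : f.domain, T y = f y) ∧ ‖T‖ ≤ C := by
  obtain ⟨g, hfg, hg⟩ := zorn_le_nonempty₀
    {g : X →ₗ.[ℝ] E | ∀ y : g.domain, ‖g y‖ ≤ C * ‖(y : X)‖} (by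
      intro c hc hchain y hy
      have hdir : DirectedOn (· ≤ ·) c := hchain.directedOn
      refine ⟨LinearPMap.sSup c hdir, ?_, fun _ => LinearPMap.le_sSup hdir⟩
      rintro ⟨x, hx⟩
      obtain ⟨p, hpc, hxp⟩ := (LinearPMap.mem_domain_sSup_iff ⟨y, hy⟩ hdir).1 hx
      have h1 : LinearPMap.sSup c hdir ⟨x, hx⟩ = p ⟨x, hxp⟩ :=
        ((LinearPMap.le_sSup hdir hpc).2 rfl).symm
      rw [h1]
      exact hc hpc ⟨x, hxp⟩) f hf
  have htop : g.domain = ⊤ := by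
    by_contra hne
    obtain ⟨x, -, hx⟩ := SetLike.exists_of_lt (lt_top_iff_ne_top.2 hne)
    obtain ⟨v, hv⟩ := step g hg.prop x
    let k := g.supSpanSingleton x v hx
    have hk : ∀ y : k.domain, ‖k y‖ ≤ C * ‖(y : X)‖ := by
      rintro ⟨y, hy⟩
      obtain ⟨u, hu, w, hw, rfl⟩ := Submodule.mem_sup.1 hy
      obtain ⟨a, rfl⟩ := Submodule.mem_span_singleton.1 hw
      have hval : k ⟨u + a • x, hy⟩ = g ⟨u, hu⟩ + a • v :=
        LinearPMap.supSpanSingleton_apply_mk g x v hx u hu a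
      rw [hval]
      rcases eq_or_ne a 0 with rfl | ha
      · simpa using hg.prop ⟨u, hu⟩
      -- Dividing by `a` reduces the bound to the vector `x - y` with `y = -(a⁻¹ • u)`.
      · have h1 := hv (-(a⁻¹ • ⟨u, hu⟩))
        have h2 : g ⟨u, hu⟩ + a • v = a • (v - g (-(a⁻¹ • ⟨u, hu⟩))) := by
          rw [LinearPMap.map_neg, LinearPMap.map_smul, sub_neg_eq_add, smul_add,
            smul_inv_smul₀ ha, add_comm]
        have h3 : u + a • x = a • (x - ((-(a⁻¹ • ⟨u, hu⟩) : g.domain) : X)) := by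
          simp [smul_add, smul_inv_smul₀ ha, add_comm]
        rw [h2]
        change _ ≤ C * ‖u + a • x‖
        rw [h3, norm_smul, norm_smul]
        calc ‖a‖ * _ ≤ ‖a‖ * _ := mul_le_mul_of_nonneg_left h1 (norm_nonneg a)
          _ = _ := by ring
    have hle : k ≤ g := hg.le_of_ge hk (g.left_le_sup _ _)
    have hxk : x ∈ k.domain :=
      Submodule.mem_sup_right (Submodule.mem_span_singleton_self x)
    exact hx (hle.1 hxk)
  let T : X →ₗ[ℝ] E := g.toFun ∘ₗ (LinearMap.id.codRestrict g.domain fun x => by simp [htop])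
  refine ⟨T.mkContinuous C fun x => hg.prop ⟨x, by simp [htop]⟩, fun y => ?_,
    LinearMap.mkContinuous_norm_le _ hC _⟩
  exact (hfg.2 (x := y) rfl).symm

/-- On passing to a subset, the density character grows at most by a factor `ℵ₀`: choose, for each
`s` and `n`, a point of `Y` at distance less than `1 / (n + 1)` from `d s` if there is one. -/
theorem DenseRange.exists_denseRange_subtype {X S : Type*} [PseudoMetricSpace X] {d : S → X}
    (hd : DenseRange d) (Y : Set X) [Nonempty Y] :
    ∃ e : S × ℕ → Y, DenseRange e := by
  classical
  have : ∀ p : S × ℕ, ∃ y : Y, (∃ y' : Y, dist (y' : X) (d p.1) < 1 / ((p.2 : ℝ) + 1)) →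
      dist (y : X) (d p.1) < 1 / ((p.2 : ℝ) + 1) := by
    intro p
    by_cases h : ∃ y' : Y, dist (y' : X) (d p.1) < 1 / ((p.2 : ℝ) + 1)
    · exact ⟨h.choose, fun _ => h.choose_spec⟩
    · exact ⟨Classical.arbitrary Y, fun h' => (h h').elim⟩
  choose e he using this
  refine ⟨e, Metric.denseRange_iff.2 fun y ε hε => ?_⟩
  obtain ⟨n, hn⟩ := exists_nat_one_div_lt (half_pos hε)
  obtain ⟨s, hs⟩ := Metric.denseRange_iff.1 hd y (1 / ((n : ℝ) + 1)) (by positivity)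
  refine ⟨(s, n), ?_⟩
  have h1 := he (s, n) ⟨y, hs⟩
  dsimp only at h1
  have h2 := dist_triangle_right (y : X) (e (s, n)) (d s)
  rw [Subtype.dist_eq]
  linarith

/-- A dense family indexed by a type in the universe of `κ`, as the definition of a good ultrafilter
requires. -/
theorem exists_denseRange_of_densityCharacter_lt {X : Type x} [TopologicalSpace X]
    {κ : Cardinal.{w}} (h : Cardinal.lift.{w} (densityCharacter X) < Cardinal.lift.{x} κ) :
    ∃ (S : Type w) (d : S → X), Cardinal.mk S < κ ∧ DenseRange d := by
  obtain ⟨D, hD, hDc⟩ : densityCharacter X ∈ {c | ∃ s : Set X, Dense s ∧ Cardinal.mk s = c} :=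
    csInf_mem ⟨_, Set.univ, dense_univ, rfl⟩
  obtain ⟨c, hc, hcκ⟩ := Cardinal.lt_lift_iff.1 h
  induction c using Cardinal.inductionOn with
  | _ S =>
    rw [← hDc] at hcκ
    obtain ⟨φ⟩ := Cardinal.lift_mk_eq'.1 hcκ
    refine ⟨S, fun s => φ s, hc, ?_⟩
    have : Set.range (fun s => (φ s : X)) = D := by
      rw [show (fun s => (φ s : X)) = Subtype.val ∘ φ from rfl, φ.surjective.range_comp,
        Subtype.range_coe]
    rw [DenseRange, this]
    exact hD

theorem mainTheorem2 {I : Type u} (U : Ultrafilter I) (κ : Cardinal.{w})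
    (hκ : Cardinal.aleph0 < κ) (hinc : CountablyIncomplete U) (hgood : IsGoodUltrafilter U κ)
    (X : I → Type v) [∀ i, NormedAddCommGroup (X i)] [∀ i, NormedSpace ℝ (X i)]
    [∀ i, CompleteSpace (X i)] (hL : IsLindenstrauss (BanachUltraproduct U X)) :
    IsCardinalInjective.{max u v, w, x} (BanachUltraproduct U X) 1 κ := by
  refine ⟨hL.1, fun Z _ _ _ hZ Y t => ?_⟩
  obtain ⟨S, d, hS, hd⟩ := exists_denseRange_of_densityCharacter_lt hZ
  have : Nonempty S := hd.nonempty_iff.2 ⟨0⟩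
  have hcard : Cardinal.mk (S × ℕ) < κ := by
    simpa using Cardinal.mul_lt_of_lt hκ.le hS hκ
  rw [one_mul]
  refine exists_extension_of_one_step (norm_nonneg t) (fun f hf z => ?_)
    ⟨Y, (t : Y →ₗ[ℝ] BanachUltraproduct U X)⟩ fun y => t.le_opNorm y
  have : Nonempty (f.domain : Set Z) := ⟨⟨0, f.domain.zero_mem⟩⟩
  obtain ⟨e, he⟩ := hd.exists_denseRange_subtype (f.domain : Set Z)
  have hLip : ∀ y y' : f.domain, ‖f y - f y'‖ ≤ ‖t‖ * ‖(y : Z) - y'‖ := by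
    intro y y'
    rw [← LinearPMap.map_sub]
    exact hf (y - y')
  obtain ⟨v, hv⟩ := BanachUltraproduct.exists_forall_norm_sub_le hκ hinc hgood hcard
    (fun p => f (e p)) (fun p => ‖t‖ * ‖z - (e p : Z)‖) fun A ε hε =>
      hL.exists_forall_norm_sub_lt_add A _ _ (fun p _ q _ => by
        refine (hLip _ _).trans ?_
        rw [← mul_add]
        gcongr
        rw [norm_sub_rev z (e p : Z)]
        exact norm_sub_le_norm_sub_add_norm_sub _ _ _) hε
  refine ⟨v, fun y => ?_⟩
  -- Both sides are continuous in `y`, so the dense family `e` suffices.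
  have hcont : Continuous fun y : f.domain => f y :=
    AddMonoidHomClass.continuous_of_bound f.toFun ‖t‖ hf
  refine he.induction_on (p := fun y : f.domain => ‖v - f y‖ ≤ ‖t‖ * ‖z - y‖) y ?_ hv
  exact isClosed_le (continuous_const.sub hcont).norm
    (continuous_const.mul (continuous_const.sub continuous_subtype_val).norm)
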